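/- Let $G$ be a compact (Hausdorff) group with normalized Haar measure, let $\langle f,g\rangle=\int_G f\bar g$ be the inner product of $L^2(G)$, and let $A$ be a non-empty index set with a matrix size $n_\alpha\ge 1$ attached to each $\alpha\in A$; write $\alpha_i^j$ $(\alpha\in A,\ 1\le i,j\le n_\alpha)$ for the resulting indices. Let $\{\chi_{\alpha_i^j}\}$ be an orthonormal family in $L^2(G)$ that is semicomplete: for every $\epsilon>0$ and every $f\in L^2(G)$ there are non-zero scalars $\gamma_j,\beta_{ij}\in\mathbb C$ and $n\in\mathbb N$ (which may depend on $\epsilon$ and $f$; in particular they may be the same for all $f$) with $$\Big\|f-\sum_{j=1}^{n}\gamma_j\sum_{i=1}^{n}\beta_{ij}\sum_{\alpha:\,i,j\le n_\alpha}\langle f,\chi_{\alpha_i^j}\rangle\,\chi_{\alpha_i^j}\Big\|_2<\epsilon .$$ Let $$L^2(G)'_{\mathfrak P}(\chi)=\{f\in L^2(G):\ \text{if }\langle f,\chi_{\alpha_i^j}\rangle=0\text{ for all }\alpha_i^j,\text{ then }f=0\}$$ be the prime-Parseval subspace. Let $L^2(A)$ be the space of functions $\varphi$ on $A$ with $\varphi(\alpha)\in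 M_{n_\alpha}(\mathbb C)$ and $\sum_{\alpha\in A}\|\varphi(\alpha)\|^2<\infty$ (Hilbert--Schmidt norm), with inner product $(\varphi,\psi)=\sum_{\alpha\in A}\operatorname{tr}(\varphi(\alpha)\psi(\alpha)^*)$. For $f\in L^2(G)$ let $\widehat f(\alpha)\in M_{n_\alpha}(\mathbb C)$ be the matrix with entries $\widehat f(\alpha)_{ij}=\langle f,\chi_{\alpha_i^j}\rangle$. Then $L^2(G)'_{\mathfrak P}(\chi)$ is a closed linear subspace of $L^2(G)$, and $f\mapsto\widehat f$ is a linear isometry of $L^2(G)'_{\mathfrak P}(\chi)$ onto $L^2(A)$; in particular $\langle f,g\rangle=\sum_{\alpha\in A}\operatorname{tr}(\widehat f(\alpha)\,\widehat g(\alpha)^*)$ for all $f,g\in L^2(G)'_{\mathfrak P}(\chi)$. -/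

import Mathlib

open MeasureTheory

/- Complex matrices carry the Hilbert-Schmidt (Frobenius) norm throughout. -/
attribute [local instance] Matrix.frobeniusNormedAddCommGroup Matrix.frobeniusNormedSpace

namespace PrimeParseval

section

variable {E : Type*} [NormedAddCommGroup E] [InnerProductSpace ℂ E]
variable {A : Type*} {d : A → ℕ}

/-- A family `χ a i j` indexed by the symbols `a_i^j` with `a : A` and `i, j < d a`
(`d a` is the matrix size at `a`), seen as a family over the set of all the symbols `a_i^j`. -/
def toFamily (χ : (a : A) → Fin (d a) → Fin (d a) → E) :
    (Σ a : A, Fin (d a) × Fin (d a)) → E :=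
  fun p => χ p.1 p.2.1 p.2.2

/-- `∑_{j < n} γ_j ∑_{i < n} β_{ij} ∑_a ⟨f, χ_{a_i^j}⟩ χ_{a_i^j}`, where the inner sum runs over
all those `a` for which the symbol `a_i^j` exists. The pairing `⟨f, g⟩`, linear in `f`, is
`inner ℂ g f`. For an orthonormal family in a complete space the inner sum converges
unconditionally, by Bessel's inequality. -/
noncomputable def semiFourierSum (χ : (a : A) → Fin (d a) → Fin (d a) → E)
    (γ : ℕ → ℂ) (β : ℕ → ℕ → ℂ) (n : ℕ) (f : E) : E :=
  ∑ j ∈ Finset.range n, γ j • ∑ i ∈ Finset.range n, β i j •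
    ∑' a : {a : A // i < d a ∧ j < d a},
      inner ℂ (χ a.1 ⟨i, a.2.1⟩ ⟨j, a.2.2⟩) f • χ a.1 ⟨i, a.2.1⟩ ⟨j, a.2.2⟩

/-- A family is semicomplete if each `f` (in `L²(G)`, `G` a compact group, this `f` is the sum
of its own Peter-Weyl series) can be approximated to every precision `ε > 0` by
its semi-Fourier sums with non-zero scalars `γ_j`, `β_{ij}`. The scalars and the number `n` may
depend on `ε` and on `f`; the variant where they depend only on `ε` is a special case,
see `isSemicomplete_of_uniform`. -/
def IsSemicomplete (χ : (a : A) → Fin (d a) → Fin (d a) → E) : Prop :=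
  ∀ ε : ℝ, 0 < ε → ∀ f : E, ∃ (γ : ℕ → ℂ) (β : ℕ → ℕ → ℂ) (n : ℕ),
    (∀ j, γ j ≠ 0) ∧ (∀ i j, β i j ≠ 0) ∧ ‖f - semiFourierSum χ γ β n f‖ < ε

theorem isSemicomplete_of_uniform (χ : (a : A) → Fin (d a) → Fin (d a) → E)
    (h : ∀ ε : ℝ, 0 < ε → ∃ (γ : ℕ → ℂ) (β : ℕ → ℕ → ℂ) (n : ℕ),
      (∀ j, γ j ≠ 0) ∧ (∀ i j, β i j ≠ 0) ∧ ∀ f : E, ‖f - semiFourierSum χ γ β n f‖ < ε) :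
    IsSemicomplete χ := by
  intro ε hε f
  obtain ⟨γ, β, n, h1, h2, h3⟩ := h ε hε
  exact ⟨γ, β, n, h1, h2, h3 f⟩

/-- The prime-Parseval subspace, as a set: those `f` for which `⟨f, χ_{a_i^j}⟩ = 0` for
all `a_i^j` implies `f = 0`. -/
def primeParseval (χ : (a : A) → Fin (d a) → Fin (d a) → E) : Set E :=
  {f | (∀ (a : A) (i j : Fin (d a)), inner ℂ (χ a i j) f = 0) → f = 0}

/-- The Fourier transform: the matrix at `a` has the entries `⟨f, χ_{a_i^j}⟩`. -/
noncomputable def fourierTransform (χ : (a : A) → Fin (d a) → Fin (d a) → E) (f : E) (a : A) :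
    Matrix (Fin (d a)) (Fin (d a)) ℂ :=
  Matrix.of fun i j => inner ℂ (χ a i j) f

end

/-- The space `L²(A)` of the functions `φ` on `A` with `φ a` a complex matrix of size `d a` and
`∑_a ‖φ a‖² < ∞`, where `‖φ a‖` is the Hilbert-Schmidt norm. -/
noncomputable abbrev MatrixL2 {A : Type*} (d : A → ℕ) : Type _ :=
  lp (fun a : A => Matrix (Fin (d a)) (Fin (d a)) ℂ) 2

end PrimeParseval

/-! Semi-Fourier sums lie in the closed span of the family, so semicompleteness makes that span
dense and the orthonormal family is a Hilbert basis (`hilbertBasis`). Only `0` is then orthogonal to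
the whole family, so the prime-Parseval set is all of `L²(G)`. What remains is Parseval
(`hasSum_trace`) and Riesz-Fischer (`fourierIsometry_surjective`) with the coefficients grouped into
one finite block per `a`: the Frobenius norm is the `ℓ²` norm of a block. -/

namespace PrimeParseval

section

variable {E : Type*} [NormedAddCommGroup E] [InnerProductSpace ℂ E]
variable {A : Type*} {d : A → ℕ}

/-- Semi-Fourier sums lie in the closed span of the family. -/
theorem semiFourierSum_mem (χ : (a : A) → Fin (d a) → Fin (d a) → E)
    (γ : ℕ → ℂ) (β : ℕ → ℕ → ℂ) (n : ℕ) (f : E) :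
    semiFourierSum χ γ β n f ∈
      (Submodule.span ℂ (Set.range (toFamily χ))).topologicalClosure := by
  refine Submodule.sum_mem _ fun j _ => Submodule.smul_mem _ _ <|
    Submodule.sum_mem _ fun i _ => Submodule.smul_mem _ _ ?_
  -- No summability is needed: a divergent `tsum` is `0`, which also lies in the subspace.
  refine tsum_mem (Submodule.isClosed_topologicalClosure _) fun a => ?_
  exact Submodule.smul_mem _ _ <| Submodule.le_topologicalClosure _ <|
    Submodule.subset_span ⟨⟨a.1, ⟨i, a.2.1⟩, ⟨j, a.2.2⟩⟩, rfl⟩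

/-- A semicomplete family has dense span. -/
theorem IsSemicomplete.span_dense {χ : (a : A) → Fin (d a) → Fin (d a) → E}
    (h : IsSemicomplete χ) :
    ⊤ ≤ (Submodule.span ℂ (Set.range (toFamily χ))).topologicalClosure := by
  intro f _
  rw [← SetLike.mem_coe,
    ← (Submodule.isClosed_topologicalClosure
      (Submodule.span ℂ (Set.range (toFamily χ)))).closure_eq, Metric.mem_closure_iff]
  intro ε hε
  obtain ⟨γ, β, n, -, -, hn⟩ := h ε hε f
  exact ⟨_, semiFourierSum_mem χ γ β n f, by rwa [dist_eq_norm]⟩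

/-- The Hilbert basis given by a semicomplete orthonormal family. -/
noncomputable def hilbertBasis [CompleteSpace E] {χ : (a : A) → Fin (d a) → Fin (d a) → E}
    (hχ : Orthonormal ℂ (toFamily χ)) (h : IsSemicomplete χ) :
    HilbertBasis (Σ a : A, Fin (d a) × Fin (d a)) ℂ E :=
  HilbertBasis.mk hχ h.span_dense

theorem hilbertBasis_apply [CompleteSpace E] {χ : (a : A) → Fin (d a) → Fin (d a) → E}
    (hχ : Orthonormal ℂ (toFamily χ)) (h : IsSemicomplete χ)
    (p : Σ a : A, Fin (d a) × Fin (d a)) :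
    hilbertBasis hχ h p = χ p.1 p.2.1 p.2.2 := by
  rw [hilbertBasis, HilbertBasis.coe_mk, toFamily]

theorem frobenius_norm_sq {n : ℕ} (M : Matrix (Fin n) (Fin n) ℂ) :
    ‖M‖ ^ 2 = ∑ p : Fin n × Fin n, ‖M p.1 p.2‖ ^ 2 := by
  rw [Matrix.frobenius_norm_def, ← Real.sqrt_eq_rpow, Real.sq_sqrt (by positivity),
    Fintype.sum_prod_type]
  simp

theorem trace_fourierTransform_mul (χ : (a : A) → Fin (d a) → Fin (d a) → E) (f g : E) (a : A) :
    Matrix.trace (fourierTransform χ f a * (fourierTransform χ g a).conjTranspose) =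
      ∑ p : Fin (d a) × Fin (d a), inner ℂ g (χ a p.1 p.2) * inner ℂ (χ a p.1 p.2) f := by
  simp [Matrix.trace, Matrix.mul_apply, fourierTransform, Fintype.sum_prod_type, mul_comm]

/-- Parseval's identity in terms of the Fourier transform. -/
theorem hasSum_trace [CompleteSpace E] {χ : (a : A) → Fin (d a) → Fin (d a) → E}
    (hχ : Orthonormal ℂ (toFamily χ)) (h : IsSemicomplete χ) (f g : E) :
    HasSum (fun a : A => Matrix.trace
      (fourierTransform χ f a * (fourierTransform χ g a).conjTranspose)) (inner ℂ g f) := by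
  have hs := (hilbertBasis hχ h).hasSum_inner_mul_inner g f
  simp only [hilbertBasis_apply] at hs
  simp only [trace_fourierTransform_mul]
  -- Summing first over the finite fibre of entries at each `a` turns the sum over all symbols into
  -- a sum of traces.
  exact hs.sigma fun a => hasSum_fintype _

/-- Plancherel's identity in terms of the Fourier transform. -/
theorem hasSum_norm_sq [CompleteSpace E] {χ : (a : A) → Fin (d a) → Fin (d a) → E}
    (hχ : Orthonormal ℂ (toFamily χ)) (h : IsSemicomplete χ) (f : E) :
    HasSum (fun a : A => ‖fourierTransform χ f a‖ ^ 2) (‖f‖ ^ 2) := by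
  have hs := hasSum_trace hχ h f f
  rw [inner_self_eq_norm_sq_to_K] at hs
  have key : ∀ a, Matrix.trace (fourierTransform χ f a * (fourierTransform χ f a).conjTranspose)
      = ((‖fourierTransform χ f a‖ ^ 2 : ℝ) : ℂ) := by
    intro a
    rw [trace_fourierTransform_mul, frobenius_norm_sq, Complex.ofReal_sum]
    refine Finset.sum_congr rfl fun p _ => ?_
    rw [← inner_conj_symm, mul_comm, Complex.mul_conj, Complex.normSq_eq_norm_sq]
    rfl
  simp only [key] at hs
  rw [← Complex.hasSum_ofReal, Complex.ofReal_pow ‖f‖]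
  exact hs

theorem memℓp_fourierTransform [CompleteSpace E] {χ : (a : A) → Fin (d a) → Fin (d a) → E}
    (hχ : Orthonormal ℂ (toFamily χ)) (h : IsSemicomplete χ) (f : E) :
    Memℓp (fourierTransform χ f) 2 :=
  memℓp_gen (by simpa using (hasSum_norm_sq hχ h f).summable)

/-- The Fourier transform as a linear isometry into `L²(A)`. -/
noncomputable def fourierIsometry [CompleteSpace E] {χ : (a : A) → Fin (d a) → Fin (d a) → E}
    (hχ : Orthonormal ℂ (toFamily χ)) (h : IsSemicomplete χ) : E →ₗᵢ[ℂ] MatrixL2 d where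
  toFun f := ⟨fourierTransform χ f, memℓp_fourierTransform hχ h f⟩
  map_add' f g := by
    ext a i j
    exact inner_add_right _ _ _
  map_smul' c f := by
    ext a i j
    exact inner_smul_right _ _ _
  norm_map' f := by
    rw [← sq_eq_sq₀ (norm_nonneg _) (norm_nonneg _)]
    refine HasSum.unique ?_ (hasSum_norm_sq hχ h f)
    simpa using lp.hasSum_norm (p := 2) (by simp)
      (⟨fourierTransform χ f, memℓp_fourierTransform hχ h f⟩ : MatrixL2 d)

theorem fourierIsometry_apply [CompleteSpace E] {χ : (a : A) → Fin (d a) → Fin (d a) → E}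
    (hχ : Orthonormal ℂ (toFamily χ)) (h : IsSemicomplete χ) (f : E) (a : A) :
    fourierIsometry hχ h f a = fourierTransform χ f a := rfl

/-- Flattens `L²(A)` to scalar `ℓ²` over all symbols, the coordinate space of the Hilbert basis. The
terms are nonnegative, so summability can be tested block by block. -/
theorem memℓp_entries (φ : MatrixL2 d) :
    Memℓp (fun p : Σ a : A, Fin (d a) × Fin (d a) => φ p.1 p.2.1 p.2.2) 2 := by
  refine memℓp_gen ?_
  have hφ : Summable fun a => ‖φ a‖ ^ 2 := by
    simpa using (lp.memℓp φ).summable (by simp)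
  simp only [ENNReal.toReal_ofNat, Real.rpow_ofNat]
  rw [summable_sigma_of_nonneg fun _ => by positivity]
  refine ⟨fun a => (hasSum_fintype _).summable, ?_⟩
  simpa only [tsum_fintype, ← frobenius_norm_sq] using hφ

theorem fourierIsometry_surjective [CompleteSpace E]
    {χ : (a : A) → Fin (d a) → Fin (d a) → E}
    (hχ : Orthonormal ℂ (toFamily χ)) (h : IsSemicomplete χ) :
    Function.Surjective (fourierIsometry hχ h) := by
  intro φ
  -- Riesz-Fischer: the preimage is the vector whose basis coefficients are the entries of `φ`.
  refine ⟨(hilbertBasis hχ h).repr.symm ⟨_, memℓp_entries φ⟩, ?_⟩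
  ext a i j
  rw [fourierIsometry_apply, fourierTransform, Matrix.of_apply,
    ← hilbertBasis_apply hχ h ⟨a, i, j⟩, ← HilbertBasis.repr_apply_apply,
    LinearIsometryEquiv.apply_symm_apply]

/-- For a semicomplete orthonormal family the prime-Parseval subspace is the whole space. -/
theorem primeParseval_eq_univ [CompleteSpace E] {χ : (a : A) → Fin (d a) → Fin (d a) → E}
    (hχ : Orthonormal ℂ (toFamily χ)) (h : IsSemicomplete χ) : primeParseval χ = Set.univ := by
  refine Set.eq_univ_of_forall fun f hf => (fourierIsometry hχ h).injective ?_
  rw [map_zero]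
  ext a i j
  exact hf a i j

end

end PrimeParseval

theorem theorem3p13 {G : Type*} [Group G] [TopologicalSpace G] [IsTopologicalGroup G]
    [CompactSpace G] [T2Space G] [MeasurableSpace G] [BorelSpace G]
    (μ : Measure G) [μ.IsHaarMeasure] [μ.Regular] [IsProbabilityMeasure μ]
    {A : Type*} [Nonempty A] (d : A → ℕ) (hd : ∀ a, 0 < d a)
    (χ : (a : A) → Fin (d a) → Fin (d a) → Lp ℂ 2 μ)
    (hχ : Orthonormal ℂ (PrimeParseval.toFamily χ))
    (hsc : PrimeParseval.IsSemicomplete χ) :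
    ∃ V : Submodule ℂ (Lp ℂ 2 μ),
      (V : Set (Lp ℂ 2 μ)) = PrimeParseval.primeParseval χ ∧
      IsClosed (V : Set (Lp ℂ 2 μ)) ∧
      ∃ H : V ≃ₗᵢ[ℂ] PrimeParseval.MatrixL2 d,
        (∀ (f : V) (a : A), H f a = PrimeParseval.fourierTransform χ (f : Lp ℂ 2 μ) a) ∧
        ∀ f g : V, HasSum (fun a : A => Matrix.trace (H f a * (H g a).conjTranspose))
          (inner ℂ (g : Lp ℂ 2 μ) (f : Lp ℂ 2 μ)) := by
  -- The subspace is everything, so closedness is trivial and the transform of the whole space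
  -- serves as `H`.
  refine ⟨⊤, ?_, isClosed_univ, (LinearIsometryEquiv.ofTop (Lp ℂ 2 μ) ⊤ rfl).trans
    (LinearIsometryEquiv.ofSurjective _
      (PrimeParseval.fourierIsometry_surjective hχ hsc)), fun f a => rfl, fun f g => ?_⟩
  · rw [PrimeParseval.primeParseval_eq_univ hχ hsc, Submodule.top_coe]
  · exact PrimeParseval.hasSum_trace hχ hsc (f : Lp ℂ 2 μ) (g : Lp ℂ 2 μ)
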